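/- A $C^\infty$-ring is a product preserving functor to sets from the category of the spaces $\mathbb R^n$ ($n\ge 0$) and smooth maps; it is finitely generated if it is a quotient of some $C^\infty(\mathbb R^n)$ by an ideal. Let $\mathrm{Sch}$ be the opposite of the category of $C^\infty$-rings; for $X\in\mathrm{Sch}$ let $C^\infty(X)$ be the corresponding $C^\infty$-ring, let $\mathrm{Spec}(A)\in\mathrm{Sch}$ be the object corresponding to a $C^\infty$-ring $A$, and let $\underline{X}=\mathrm{Hom}_{\mathrm{Sch}}(-,X)$ be the represented pre-sheaf. The ring $C^\infty(X\times X)$ is the coproduct of two copies of $C^\infty(X)$ in $C^\infty$-rings, and $I_\Delta$ denotes the kernel of the codiagonal $C^\infty(X\times X)\to C^\infty(X)$. For an ideal $I$ of a $C^\infty$-ring $A$ let $\sqrt[\mathrm{nil}]{I}$ be its nilradical, and let $\sqrt[\infty]{I}=\{f\in A : (A/I)\{f^{-1}\}\cong 0\}$ be its $\infty$-radical, where $B\{f^{-1}\}$ is the $C^\infty$-ring obtained from $B$ by universally inverting $f$. Define the formal neighbourhood and the $\infty$-neighbourhood of the diagonal of $X$ by $$N_{\mathrm{nil}}(\Delta_X)=\operatorname*{colim}_{I:\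 \sqrt[\mathrm{nil}]{I}=\sqrt[\mathrm{nil}]{I_\Delta}}\underline{\mathrm{Spec}(C^\infty(X\times X)/I)},\qquad N_{\infty}(\Delta_X)=\operatorname*{colim}_{I:\ \sqrt[\infty]{I}=\sqrt[\infty]{I_\Delta}}\underline{\mathrm{Spec}(C^\infty(X\times X)/I)},$$ where the ideals $I$ of $C^\infty(X\times X)$ are ordered by reverse inclusion and all colimits are taken in the category of pre-sheaves of sets on $\mathrm{Sch}$. Proposition. Suppose that $C^\infty(X)$ is finitely generated. Then $$N_{\mathrm{nil}}(\Delta_X)\cong\operatorname*{colim}_{k\in\mathbb Z_{\ge 1}}\underline{\mathrm{Spec}(C^\infty(X\times X)/I_\Delta^{k})},\qquad N_{\infty}(\Delta_X)\cong\operatorname*{colim}_{f}\underline{\mathrm{Spec}(C^\infty(X\times X)/(f))},$$ where in the second colimit $f$ runs over the elements of $C^\infty(X\times X)$ with $\sqrt[\infty]{(f)}=\sqrt[\infty]{I_\Delta}$, ordered by reverse inclusion of the ideals $(f)$. Both isomorphisms are compatible with the canonical maps from $\underline{\mathrm{Spec}(C^\infty(X\times X)/I_\Delta^k)}$ and $\underline{\mathrm{Spec}(C^\infty(X\times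 X)/(f))}$ to the two sides. -/

import Mathlib

open CategoryTheory Limits
open scoped ContDiff

universe u v w

namespace CInf

/-! Smooth functions on `ℝⁿ` and their clone structure -/

/-- The ring `C^∞(ℝⁿ)` of smooth real functions on `ℝⁿ`. -/
def smoothSubring (n : ℕ) : Subring ((Fin n → ℝ) → ℝ) where
  carrier := {f | ContDiff ℝ ∞ f}
  mul_mem' {f g} (hf : ContDiff ℝ ∞ f) (hg : ContDiff ℝ ∞ g) := hf.mul hg
  one_mem' := contDiff_const (𝕜 := ℝ) (n := ∞) (c := (1 : ℝ))
  add_mem' {f g} (hf : ContDiff ℝ ∞ f) (hg : ContDiff ℝ ∞ g) := hf.add hg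
  zero_mem' := contDiff_const (𝕜 := ℝ) (n := ∞) (c := (0 : ℝ))
  neg_mem' {f} (hf : ContDiff ℝ ∞ f) := hf.neg

/-- `Smooth n` is `C^∞(ℝⁿ)`. -/
abbrev Smooth (n : ℕ) : Type := smoothSubring n

namespace Smooth

theorem contDiff {n : ℕ} (f : Smooth n) : ContDiff ℝ ∞ f.1 := f.2

/-- The `i`-th coordinate function on `ℝⁿ`. -/
def proj {n : ℕ} (i : Fin n) : Smooth n :=
  ⟨fun x => x i, show ContDiff ℝ ∞ _ from contDiff_apply ℝ ℝ i⟩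

/-- The composite `x ↦ f (g₁ x, …, g_m x)`. -/
def comp {m n : ℕ} (f : Smooth m) (g : Fin m → Smooth n) : Smooth n :=
  ⟨fun x => f.1 fun j => (g j).1 x,
    show ContDiff ℝ ∞ _ from f.contDiff.comp (contDiff_pi.2 fun j => (g j).contDiff)⟩

@[simp] theorem proj_apply {n : ℕ} (i : Fin n) (x : Fin n → ℝ) : (proj i).1 x = x i := rfl

@[simp] theorem comp_apply {m n : ℕ} (f : Smooth m) (g : Fin m → Smooth n) (x : Fin n → ℝ) :
    (comp f g).1 x = f.1 fun j => (g j).1 x := rfl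

/-- Addition `ℝ² → ℝ`. -/
def add₂ : Smooth 2 := proj 0 + proj 1

/-- Multiplication `ℝ² → ℝ`. -/
def mul₂ : Smooth 2 := proj 0 * proj 1

end Smooth

/-! `C^∞`-rings -/

/-- A set on which every smooth function `ℝⁿ → ℝ` acts as an `n`-ary operation, compatibly with
coordinate functions and composition; equivalently, a finite product preserving functor from
the category of the spaces `ℝⁿ` and smooth maps to sets. -/
class SmoothOps (A : Type u) where
  op : ∀ {n : ℕ}, Smooth n → (Fin n → A) → A
  op_proj : ∀ {n : ℕ} (i : Fin n) (a : Fin n → A), op (Smooth.proj i) a = a i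
  op_comp : ∀ {m n : ℕ} (f : Smooth m) (g : Fin m → Smooth n) (a : Fin n → A),
    op (Smooth.comp f g) a = op f fun j => op (g j) a

/-- A `C^∞`-ring. The commutative ring structure is the one that the smooth functions `x + y` and
`x * y` define (it is recorded only to have it available by name). -/
class CInfRing (A : Type u) extends CommRing A, SmoothOps A where
  op_add₂ : ∀ a b : A, op Smooth.add₂ ![a, b] = a + b
  op_mul₂ : ∀ a b : A, op Smooth.mul₂ ![a, b] = a * b

open SmoothOps

namespace SmoothOps

theorem op_pair {A : Type u} [SmoothOps A] {n : ℕ} (F : Smooth 2) (f g : Smooth n)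
    (v : Fin n → A) : op F ![op f v, op g v] = op (Smooth.comp F ![f, g]) v := by
  rw [op_comp]
  congr 1
  funext j
  fin_cases j <;> rfl

theorem op_add_aux {A : Type u} [SmoothOps A] {n : ℕ} (f g : Smooth n) (v : Fin n → A) :
    op Smooth.add₂ ![op f v, op g v] = op (f + g) v := op_pair _ f g v

theorem op_mul_aux {A : Type u} [SmoothOps A] {n : ℕ} (f g : Smooth n) (v : Fin n → A) :
    op Smooth.mul₂ ![op f v, op g v] = op (f * g) v := op_pair _ f g v

theorem op_const {A : Type u} [SmoothOps A] {n : ℕ} (c : Smooth 0) (v : Fin n → A) :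
    op c ![] = op (Smooth.comp c ![]) v := by
  rw [op_comp]
  congr 1
  funext j
  exact j.elim0

theorem op_zero_aux {A : Type u} [SmoothOps A] {n : ℕ} (v : Fin n → A) :
    op (0 : Smooth 0) ![] = op (0 : Smooth n) v := op_const _ v

theorem op_one_aux {A : Type u} [SmoothOps A] {n : ℕ} (v : Fin n → A) :
    op (1 : Smooth 0) ![] = op (1 : Smooth n) v := op_const _ v

theorem op_neg_aux {A : Type u} [SmoothOps A] {n : ℕ} (f : Smooth n) (v : Fin n → A) :
    op (-Smooth.proj 0 : Smooth 1) ![op f v] = op (-f) v := by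
  have : -f = Smooth.comp (-Smooth.proj 0 : Smooth 1) ![f] := rfl
  rw [this, op_comp]
  congr 1
  funext j
  fin_cases j
  rfl

theorem exists_common {A : Type u} [SmoothOps A] (a b c : A) :
    ∃ (v : Fin 3 → A) (f g h : Smooth 3), a = op f v ∧ b = op g v ∧ c = op h v :=
  ⟨![a, b, c], Smooth.proj 0, Smooth.proj 1, Smooth.proj 2,
    (op_proj 0 ![a, b, c]).symm, (op_proj 1 ![a, b, c]).symm, (op_proj 2 ![a, b, c]).symm⟩

/-- The commutative ring structure defined by the smooth operations. -/
abbrev toCommRing (A : Type u) [SmoothOps A] : CommRing A where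
  add a b := op Smooth.add₂ ![a, b]
  mul a b := op Smooth.mul₂ ![a, b]
  zero := op (0 : Smooth 0) ![]
  one := op (1 : Smooth 0) ![]
  neg a := op (-Smooth.proj 0 : Smooth 1) ![a]
  nsmul := @nsmulRec A ⟨op (0 : Smooth 0) ![]⟩ ⟨fun a b => op Smooth.add₂ ![a, b]⟩
  zsmul := @zsmulRec A ⟨op (0 : Smooth 0) ![]⟩ ⟨fun a b => op Smooth.add₂ ![a, b]⟩
    ⟨fun a => op (-Smooth.proj 0 : Smooth 1) ![a]⟩
    (@nsmulRec A ⟨op (0 : Smooth 0) ![]⟩ ⟨fun a b => op Smooth.add₂ ![a, b]⟩)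
  add_assoc a b c := by
    obtain ⟨v, f, g, h, rfl, rfl, rfl⟩ := exists_common a b c
    change op _ ![op _ ![_, _], _] = op _ ![_, op _ ![_, _]]
    simp only [op_add_aux, add_assoc]
  zero_add a := by
    obtain ⟨v, f, -, -, rfl, -, -⟩ := exists_common a a a
    change op _ ![op 0 ![], _] = _
    rw [op_zero_aux v, op_add_aux, zero_add]
  add_zero a := by
    obtain ⟨v, f, -, -, rfl, -, -⟩ := exists_common a a a
    change op _ ![_, op 0 ![]] = _
    rw [op_zero_aux v, op_add_aux, add_zero]
  add_comm a b := by
    obtain ⟨v, f, g, -, rfl, rfl, -⟩ := exists_common a b b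
    change op _ ![_, _] = op _ ![_, _]
    simp only [op_add_aux, add_comm]
  mul_assoc a b c := by
    obtain ⟨v, f, g, h, rfl, rfl, rfl⟩ := exists_common a b c
    change op _ ![op _ ![_, _], _] = op _ ![_, op _ ![_, _]]
    simp only [op_mul_aux, mul_assoc]
  one_mul a := by
    obtain ⟨v, f, -, -, rfl, -, -⟩ := exists_common a a a
    change op _ ![op 1 ![], _] = _
    rw [op_one_aux v, op_mul_aux, one_mul]
  mul_one a := by
    obtain ⟨v, f, -, -, rfl, -, -⟩ := exists_common a a a
    change op _ ![_, op 1 ![]] = _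
    rw [op_one_aux v, op_mul_aux, mul_one]
  mul_comm a b := by
    obtain ⟨v, f, g, -, rfl, rfl, -⟩ := exists_common a b b
    change op _ ![_, _] = op _ ![_, _]
    simp only [op_mul_aux, mul_comm]
  left_distrib a b c := by
    obtain ⟨v, f, g, h, rfl, rfl, rfl⟩ := exists_common a b c
    change op _ ![_, op _ ![_, _]] = op _ ![op _ ![_, _], op _ ![_, _]]
    simp only [op_mul_aux, op_add_aux, mul_add]
  right_distrib a b c := by
    obtain ⟨v, f, g, h, rfl, rfl, rfl⟩ := exists_common a b c
    change op _ ![op _ ![_, _], _] = op _ ![op _ ![_, _], op _ ![_, _]]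
    simp only [op_mul_aux, op_add_aux, add_mul]
  zero_mul a := by
    obtain ⟨v, f, -, -, rfl, -, -⟩ := exists_common a a a
    change op _ ![op 0 ![], _] = op 0 ![]
    rw [op_zero_aux v, op_mul_aux, zero_mul]
  mul_zero a := by
    obtain ⟨v, f, -, -, rfl, -, -⟩ := exists_common a a a
    change op _ ![_, op 0 ![]] = op 0 ![]
    rw [op_zero_aux v, op_mul_aux, mul_zero]
  neg_add_cancel a := by
    obtain ⟨v, f, -, -, rfl, -, -⟩ := exists_common a a a
    change op _ ![op _ ![_], _] = op 0 ![]
    rw [op_zero_aux v, op_neg_aux, op_add_aux, neg_add_cancel]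

/-- A set with smooth operations is a `C^∞`-ring. -/
abbrev toCInfRing (A : Type u) [SmoothOps A] : CInfRing A :=
  { toCommRing A with
    op_add₂ := fun _ _ => rfl
    op_mul₂ := fun _ _ => rfl }

end SmoothOps

/-- `C^∞(ℝⁿ)` is a `C^∞`-ring by composition. -/
instance instCInfRingSmooth (n : ℕ) : CInfRing (Smooth n) where
  op f a := Smooth.comp f a
  op_proj _ _ := rfl
  op_comp _ _ _ := rfl
  op_add₂ _ _ := rfl
  op_mul₂ _ _ := rfl

namespace CInfRing

/-- For fixed arguments `a`, the map `f ↦ f(a)` is a ring homomorphism `C^∞(ℝⁿ) → A`. -/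
def eval {A : Type u} [CInfRing A] {n : ℕ} (a : Fin n → A) : Smooth n →+* A where
  toFun f := op f a
  map_mul' f g := by rw [← op_mul_aux, op_mul₂]
  map_add' f g := by rw [← op_add_aux, op_add₂]
  map_zero' := by
    have h : op (0 : Smooth n) a + op (0 : Smooth n) a = op (0 : Smooth n) a := by
      rw [← op_add₂, op_add_aux, add_zero]
    simpa using h
  map_one' := by
    have h : op (1 : Smooth 1) ![(1 : A)] * op (Smooth.proj 0 : Smooth 1) ![(1 : A)] =
        op (Smooth.proj 0 : Smooth 1) ![(1 : A)] := by
      rw [← op_mul₂, op_mul_aux, one_mul]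
    rw [op_proj] at h
    rw [← op_one_aux, op_one_aux ![(1 : A)]]
    simpa using h

@[simp] theorem eval_apply {A : Type u} [CInfRing A] {n : ℕ} (a : Fin n → A) (f : Smooth n) :
    eval a f = op f a := rfl

end CInfRing

/-- A morphism of `C^∞`-rings: a map that commutes with all smooth operations. -/
@[ext]
structure CInfHom (A : Type u) (B : Type v) [CInfRing A] [CInfRing B] where
  toFun : A → B
  map_op : ∀ {n : ℕ} (f : Smooth n) (a : Fin n → A), toFun (op f a) = op f fun i => toFun (a i)

namespace CInfHom

instance {A : Type u} {B : Type v} [CInfRing A] [CInfRing B] : FunLike (CInfHom A B) A B where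
  coe := toFun
  coe_injective _ _ h := CInfHom.ext h

/-- The identity morphism. -/
def id (A : Type u) [CInfRing A] : CInfHom A A := ⟨fun a => a, fun _ _ => rfl⟩

/-- Composition of morphisms. -/
def comp {A : Type u} {B : Type v} {C : Type w} [CInfRing A] [CInfRing B] [CInfRing C]
    (g : CInfHom B C) (f : CInfHom A B) : CInfHom A C :=
  ⟨fun a => g.toFun (f.toFun a), fun F a => by rw [f.map_op, g.map_op]⟩

/-- The underlying ring homomorphism. -/
def toRingHom {A : Type u} {B : Type v} [CInfRing A] [CInfRing B] (φ : CInfHom A B) :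
    A →+* B where
  toFun := φ.toFun
  map_mul' a b := by
    rw [← CInfRing.op_mul₂, φ.map_op, ← CInfRing.op_mul₂]
    congr 1; funext j; fin_cases j <;> rfl
  map_add' a b := by
    rw [← CInfRing.op_add₂, φ.map_op, ← CInfRing.op_add₂]
    congr 1; funext j; fin_cases j <;> rfl
  map_zero' := by
    rw [show (0 : A) = op (0 : Smooth 0) ![] from (map_zero (CInfRing.eval _)).symm, φ.map_op]
    exact map_zero (CInfRing.eval _)
  map_one' := by
    rw [show (1 : A) = op (1 : Smooth 0) ![] from (map_one (CInfRing.eval _)).symm, φ.map_op]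
    exact map_one (CInfRing.eval _)

end CInfHom

/-- A `C^∞`-ring is finitely generated if it is a quotient of some `C^∞(ℝⁿ)`. -/
def IsFinitelyGenerated (A : Type u) [CInfRing A] : Prop :=
  ∃ (n : ℕ) (φ : CInfHom (Smooth n) A), Function.Surjective φ

/-! Quotients by ideals: every ideal is a congruence for the smooth operations -/

theorem contDiff_unitIntegral {E : Type} [NormedAddCommGroup E] [NormedSpace ℝ E]
    [FiniteDimensional ℝ E] (n : ℕ) :
    ∀ {G : Type} [NormedAddCommGroup G] [NormedSpace ℝ G] [CompleteSpace G] (F : E × ℝ → G),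
      ContDiff ℝ ∞ F → ContDiff ℝ n (fun x => ∫ t in (0 : ℝ)..1, F (x, t)) := by
  induction n with
  | zero =>
    intro G _ _ _ F hF
    have hc : Continuous F := hF.continuous
    exact contDiff_zero.2
      (intervalIntegral.continuous_parametric_intervalIntegral_of_continuous' (by fun_prop) 0 1)
  | succ n ih =>
    intro G _ _ _ F hF
    have hd : ContDiff ℝ ∞ (fun p : E × ℝ => (fderiv ℝ F p).comp (ContinuousLinearMap.inl ℝ E ℝ)) :=
      (hF.fderiv_right (m := ∞) (by simp)).clm_comp contDiff_const
    have hFc : Continuous F := hF.continuous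
    have hdc := hd.continuous
    have := ih _ hd
    rw [Nat.cast_succ, contDiff_succ_iff_hasFDerivAt]
    refine ⟨_, this, fun x => ?_⟩
    have hK : IsCompact (Metric.closedBall x 1 ×ˢ Set.Icc (0 : ℝ) 1) :=
      (isCompact_closedBall x 1).prod isCompact_Icc
    obtain ⟨C, hC⟩ := hK.exists_bound_of_continuousOn hdc.continuousOn
    refine (intervalIntegral.hasFDerivAt_integral_of_dominated_of_fderiv_le
      (F := fun x t => F (x, t)) (s := Metric.ball x 1) (bound := fun _ => C)
      (F' := fun x t => (fderiv ℝ F (x, t)).comp (ContinuousLinearMap.inl ℝ E ℝ))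
      (Metric.ball_mem_nhds x one_pos) ?_ ?_ ?_ ?_ ?_ ?_)
    · exact Filter.Eventually.of_forall fun y =>
        (hFc.comp (by fun_prop : Continuous fun t : ℝ => (y, t))).aestronglyMeasurable
    · exact (hFc.comp (by fun_prop : Continuous fun t : ℝ => (x, t))).intervalIntegrable _ _
    · exact (hdc.comp (by fun_prop : Continuous fun t : ℝ => (x, t))).aestronglyMeasurable
    · refine Filter.Eventually.of_forall fun t ht y hy => hC (y, t) ⟨Metric.ball_subset_closedBall hy, ?_⟩
      rw [Set.uIoc_of_le zero_le_one] at ht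
      exact ⟨ht.1.le, ht.2⟩
    · exact intervalIntegrable_const
    · refine Filter.Eventually.of_forall fun t ht y hy => ?_
      have h1 := (hF.differentiable (by simp) (y, t)).hasFDerivAt
      have h2 : HasFDerivAt (fun z : E => (z, t)) (ContinuousLinearMap.inl ℝ E ℝ) y :=
        hasFDerivAt_prodMk_left y t
      exact h1.comp y h2

theorem exists_smooth_difference_quotients {n : ℕ} (f : (Fin n → ℝ) → ℝ) (hf : ContDiff ℝ ∞ f) :
    ∃ g : Fin n → ((Fin n → ℝ) × (Fin n → ℝ)) → ℝ, (∀ i, ContDiff ℝ ∞ (g i)) ∧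
      ∀ x y, f x - f y = ∑ i, (x i - y i) * g i (x, y) := by
  refine ⟨fun i p => ∫ t in (0 : ℝ)..1,
    fderiv ℝ f (p.2 + t • (p.1 - p.2)) (Pi.single i 1), fun i => ?_, fun x y => ?_⟩
  · refine contDiff_infty.2 fun k => contDiff_unitIntegral k
      (fun q : ((Fin n → ℝ) × (Fin n → ℝ)) × ℝ =>
        fderiv ℝ f (q.1.2 + q.2 • (q.1.1 - q.1.2)) (Pi.single i 1)) ?_
    exact ((hf.fderiv_right (m := ∞) (by simp)).comp (by fun_prop)).clm_apply contDiff_const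
  · have hc : Continuous (fderiv ℝ f) := (hf.fderiv_right (m := ∞) (by simp)).continuous
    have hder : ∀ t : ℝ, HasDerivAt (fun t : ℝ => f (y + t • (x - y)))
        (fderiv ℝ f (y + t • (x - y)) (x - y)) t := fun t => by
      have h1 := (hf.differentiable (by simp) (y + t • (x - y))).hasFDerivAt
      have h2 : HasDerivAt (fun t : ℝ => y + t • (x - y)) (x - y) t := by
        simpa using ((hasDerivAt_id t).smul_const (x - y)).const_add y
      exact h1.comp_hasDerivAt t h2
    have hint := intervalIntegral.integral_eq_sub_of_hasDerivAt (a := 0) (b := 1)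
      (fun t _ => hder t) (Continuous.intervalIntegrable (by fun_prop) _ _)
    have hsum : x - y = ∑ i, (x i - y i) • (Pi.single i (1 : ℝ) : Fin n → ℝ) := by
      ext j
      simp [Finset.sum_apply, Pi.single_apply]
    have : f x - f y = ∫ t in (0 : ℝ)..1, fderiv ℝ f (y + t • (x - y)) (x - y) := by
      rw [hint]; simp
    rw [this]
    calc _ = ∫ t in (0 : ℝ)..1, ∑ i, (x i - y i) *
          fderiv ℝ f (y + t • (x - y)) (Pi.single i 1) := by
            congr 1; funext t
            conv_lhs => arg 2; rw [hsum]
            simp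
      _ = _ := by
        rw [intervalIntegral.integral_finsetSum]
        · simp
        · exact fun i _ => Continuous.intervalIntegrable (by fun_prop) _ _

theorem op_sub_mem {A : Type u} [CInfRing A] (I : Ideal A) {n : ℕ} (f : Smooth n)
    (a b : Fin n → A) (h : ∀ i, a i - b i ∈ I) : op f a - op f b ∈ I := by
  obtain ⟨g, hg, hfg⟩ := exists_smooth_difference_quotients f.1 f.contDiff
  let p : Fin n → Smooth (n + n) := fun i => Smooth.proj (Fin.castAdd n i)
  let q : Fin n → Smooth (n + n) := fun i => Smooth.proj (Fin.natAdd n i)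
  let g' : Fin n → Smooth (n + n) := fun i =>
    ⟨fun z => g i (fun j => z (Fin.castAdd n j), fun j => z (Fin.natAdd n j)),
      show ContDiff ℝ ∞ _ from (hg i).comp ((contDiff_pi.2 fun j => contDiff_apply ℝ ℝ _).prodMk
        (contDiff_pi.2 fun j => contDiff_apply ℝ ℝ _))⟩
  have key : Smooth.comp f p - Smooth.comp f q = ∑ i, (p i - q i) * g' i := by
    apply Subtype.ext
    funext z
    have := hfg (fun j => z (Fin.castAdd n j)) (fun j => z (Fin.natAdd n j))
    simp only [AddSubgroupClass.coe_sub, Pi.sub_apply, Smooth.comp_apply, p, q, Smooth.proj_apply,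
      AddSubmonoidClass.coe_finsetSum, MulMemClass.coe_mul, Finset.sum_apply, Pi.mul_apply]
    exact this
  have hv := congrArg (CInfRing.eval (Fin.append a b)) key
  simp only [map_sub, map_sum, map_mul, CInfRing.eval_apply, SmoothOps.op_comp, p, q, op_proj,
    Fin.append_left, Fin.append_right] at hv
  rw [hv]
  exact I.sum_mem fun i _ => I.mul_mem_right _ (h i)

/-- The quotient `C^∞`-ring `A ⧸ I`; its underlying ring is the usual quotient ring. -/
noncomputable instance instCInfRingQuotient {A : Type u} [CInfRing A] (I : Ideal A) :
    CInfRing (A ⧸ I) where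
  op f a := Ideal.Quotient.mk I (op f fun i => (a i).out)
  op_proj i a := by
    rw [op_proj]; exact Ideal.Quotient.mk_out _
  op_comp f g a := by
    rw [SmoothOps.op_comp, Ideal.Quotient.eq]
    refine op_sub_mem I f _ _ fun j => ?_
    rw [← Ideal.Quotient.eq, Ideal.Quotient.mk_out]
  op_add₂ a b := by
    refine Eq.trans ?_ (congrArg₂ (· + ·) (Ideal.Quotient.mk_out a) (Ideal.Quotient.mk_out b))
    rw [← map_add, ← CInfRing.op_add₂]
    congr 2; funext j; fin_cases j <;> rfl
  op_mul₂ a b := by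
    refine Eq.trans ?_ (congrArg₂ (· * ·) (Ideal.Quotient.mk_out a) (Ideal.Quotient.mk_out b))
    rw [← map_mul, ← CInfRing.op_mul₂]
    congr 2; funext j; fin_cases j <;> rfl

/-- The quotient morphism `A → A ⧸ I`. -/
noncomputable def quotientMk {A : Type u} [CInfRing A] (I : Ideal A) : CInfHom A (A ⧸ I) where
  toFun := Ideal.Quotient.mk I
  map_op f a := by
    change _ = Ideal.Quotient.mk I _
    rw [Ideal.Quotient.eq]
    refine op_sub_mem I f _ _ fun j => ?_
    rw [← Ideal.Quotient.eq, Ideal.Quotient.mk_out]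

/-- The projection `A ⧸ I → A ⧸ J` for `I ≤ J`. -/
noncomputable def quotientFactor {A : Type u} [CInfRing A] {I J : Ideal A} (h : I ≤ J) :
    CInfHom (A ⧸ I) (A ⧸ J) where
  toFun := Ideal.Quotient.factor h
  map_op f a := by
    have h1 : op f a = Ideal.Quotient.mk I (op f fun i => (a i).out) := rfl
    rw [h1, Ideal.Quotient.factor_mk]
    refine ((quotientMk J).map_op f _).trans ?_
    congr 1
    funext i
    change Ideal.Quotient.mk J (a i).out = _
    rw [← Ideal.Quotient.factor_mk h, Ideal.Quotient.mk_out]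

/-! Coproducts of `C^∞`-rings, by generators and relations -/

/-- Formal smooth expressions in elements of `A` and of `B`. -/
inductive CoprodTerm (A : Type u) (B : Type v) : Type max u v
  | inl (a : A) : CoprodTerm A B
  | inr (b : B) : CoprodTerm A B
  | op {n : ℕ} (f : Smooth n) (t : Fin n → CoprodTerm A B) : CoprodTerm A B

/-- The smallest congruence that imposes the axioms of `C^∞`-rings and makes the inclusions of `A`
and `B` into morphisms. -/
inductive CoprodRel (A : Type u) (B : Type v) [CInfRing A] [CInfRing B] :
    CoprodTerm A B → CoprodTerm A B → Prop
  | refl (s : CoprodTerm A B) : CoprodRel A B s s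
  | symm {s t : CoprodTerm A B} : CoprodRel A B s t → CoprodRel A B t s
  | trans {s t r : CoprodTerm A B} : CoprodRel A B s t → CoprodRel A B t r → CoprodRel A B s r
  | op_congr {n : ℕ} (f : Smooth n) (s t : Fin n → CoprodTerm A B) :
      (∀ i, CoprodRel A B (s i) (t i)) → CoprodRel A B (.op f s) (.op f t)
  | op_proj {n : ℕ} (i : Fin n) (t : Fin n → CoprodTerm A B) :
      CoprodRel A B (.op (Smooth.proj i) t) (t i)
  | op_comp {m n : ℕ} (f : Smooth m) (g : Fin m → Smooth n) (t : Fin n → CoprodTerm A B) :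
      CoprodRel A B (.op (Smooth.comp f g) t) (.op f fun j => .op (g j) t)
  | inl_op {n : ℕ} (f : Smooth n) (a : Fin n → A) :
      CoprodRel A B (.inl (SmoothOps.op f a)) (.op f fun i => .inl (a i))
  | inr_op {n : ℕ} (f : Smooth n) (b : Fin n → B) :
      CoprodRel A B (.inr (SmoothOps.op f b)) (.op f fun i => .inr (b i))

/-- The congruence as a setoid. -/
def coprodSetoid (A : Type u) (B : Type v) [CInfRing A] [CInfRing B] :
    Setoid (CoprodTerm A B) :=
  ⟨CoprodRel A B, CoprodRel.refl, CoprodRel.symm, CoprodRel.trans⟩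

/-- The coproduct of two `C^∞`-rings. -/
def Coprod (A : Type u) (B : Type v) [CInfRing A] [CInfRing B] : Type max u v :=
  Quotient (coprodSetoid A B)

namespace Coprod

section

variable {A : Type u} {B : Type v} [CInfRing A] [CInfRing B]

theorem mk_op_out {n : ℕ} (f : Smooth n) (t : Fin n → CoprodTerm A B) :
    Quotient.mk (coprodSetoid A B) (.op f fun i => (Quotient.mk (coprodSetoid A B) (t i)).out) =
      Quotient.mk (coprodSetoid A B) (.op f t) :=
  Quotient.sound (CoprodRel.op_congr f _ _ fun i =>
    Quotient.exact (s := coprodSetoid A B) (Quotient.out_eq _))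

noncomputable instance instSmoothOps : SmoothOps (Coprod A B) where
  op f x := Quotient.mk (coprodSetoid A B) (.op f fun i => (x i).out)
  op_proj i _ := (Quotient.sound (CoprodRel.op_proj i _)).trans (Quotient.out_eq _)
  op_comp f g _ := (Quotient.sound (CoprodRel.op_comp f g _)).trans (mk_op_out f _).symm

noncomputable instance instCInfRing : CInfRing (Coprod A B) := SmoothOps.toCInfRing _

theorem op_mk {n : ℕ} (f : Smooth n) (t : Fin n → CoprodTerm A B) :
    (op f fun i => (show Coprod A B from Quotient.mk (coprodSetoid A B) (t i))) =
      Quotient.mk (coprodSetoid A B) (.op f t) := mk_op_out f t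

variable (A B) in
/-- The first inclusion. -/
noncomputable def inl : CInfHom A (Coprod A B) where
  toFun a := Quotient.mk (coprodSetoid A B) (.inl a)
  map_op f a := (Quotient.sound (CoprodRel.inl_op f a)).trans (op_mk f _).symm

variable (A B) in
/-- The second inclusion. -/
noncomputable def inr : CInfHom B (Coprod A B) where
  toFun b := Quotient.mk (coprodSetoid A B) (.inr b)
  map_op f b := (Quotient.sound (CoprodRel.inr_op f b)).trans (op_mk f _).symm

/-- Evaluation of formal expressions along two morphisms. -/
def descTerm {C : Type w} [CInfRing C] (φ : CInfHom A C) (ψ : CInfHom B C) :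
    CoprodTerm A B → C
  | .inl a => φ.toFun a
  | .inr b => ψ.toFun b
  | .op f t => SmoothOps.op f fun i => descTerm φ ψ (t i)

theorem descTerm_eq {C : Type w} [CInfRing C] (φ : CInfHom A C) (ψ : CInfHom B C)
    {s t : CoprodTerm A B} (h : CoprodRel A B s t) : descTerm φ ψ s = descTerm φ ψ t := by
  induction h with
  | refl => rfl
  | symm _ ih => exact ih.symm
  | trans _ _ ih₁ ih₂ => exact ih₁.trans ih₂
  | op_congr f s t _ ih => exact congrArg (SmoothOps.op f) (funext ih)
  | op_proj i t => exact SmoothOps.op_proj i _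
  | op_comp f g t => exact SmoothOps.op_comp f g _
  | inl_op f a => exact φ.map_op f a
  | inr_op f b => exact ψ.map_op f b

/-- The morphism out of the coproduct induced by two morphisms. -/
noncomputable def desc {C : Type w} [CInfRing C] (φ : CInfHom A C) (ψ : CInfHom B C) :
    CInfHom (Coprod A B) C where
  toFun := Quotient.lift (descTerm φ ψ) fun _ _ h => descTerm_eq φ ψ h
  map_op f x := by
    obtain ⟨t, rfl⟩ : ∃ t : _ → CoprodTerm A B,
        x = fun i => (show Coprod A B from Quotient.mk (coprodSetoid A B) (t i)) :=
      ⟨fun i => (x i).out, funext fun i => (Quotient.out_eq _).symm⟩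
    rw [op_mk]
    rfl

theorem desc_inl {C : Type w} [CInfRing C] (φ : CInfHom A C) (ψ : CInfHom B C) :
    (desc φ ψ).comp (inl A B) = φ := rfl

theorem desc_inr {C : Type w} [CInfRing C] (φ : CInfHom A C) (ψ : CInfHom B C) :
    (desc φ ψ).comp (inr A B) = ψ := rfl

theorem hom_ext {C : Type w} [CInfRing C] {φ ψ : CInfHom (Coprod A B) C}
    (h₁ : φ.comp (inl A B) = ψ.comp (inl A B)) (h₂ : φ.comp (inr A B) = ψ.comp (inr A B)) :
    φ = ψ := by
  apply CInfHom.ext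
  funext x
  induction x using Quotient.inductionOn with
  | h t =>
    induction t with
    | inl a => exact congrArg (fun χ : CInfHom A C => χ.toFun a) h₁
    | inr b => exact congrArg (fun χ : CInfHom B C => χ.toFun b) h₂
    | op f t ih =>
      rw [← op_mk, φ.map_op, ψ.map_op]
      exact congrArg (SmoothOps.op f) (funext ih)

end

end Coprod

/-! Localization and the `∞`-radical -/

/-- The `C^∞`-localization `A{a⁻¹}`: a free variable `x` is adjoined to `A`, that is, the coproduct
with `C^∞(ℝ)` is taken, and the relation `a x = 1` is imposed. -/
abbrev SmoothLocalization (A : Type u) [CInfRing A] (a : A) : Type u :=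
  Coprod A (Smooth 1) ⧸ Ideal.span
    {(Coprod.inl A (Smooth 1) a * Coprod.inr A (Smooth 1) (Smooth.proj 0) - 1 :
      Coprod A (Smooth 1))}

/-- The `∞`-radical of an ideal `I`: the elements `f` such that `(A ⧸ I){f⁻¹}` is the zero ring. -/
noncomputable def infRadical {A : Type u} [CInfRing A] (I : Ideal A) : Set A :=
  {f | Subsingleton (SmoothLocalization (A ⧸ I) (Ideal.Quotient.mk I f))}

/-! The categories of `C^∞`-rings and of `C^∞`-schemes -/

/-- Bundled `C^∞`-rings. -/
structure CInfRingCat : Type (u + 1) where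
  carrier : Type u
  [str : CInfRing carrier]

attribute [instance] CInfRingCat.str

instance : Category.{u} CInfRingCat.{u} where
  Hom A B := CInfHom A.carrier B.carrier
  id A := CInfHom.id A.carrier
  comp f g := g.comp f

/-- The opposite category of the category of `C^∞`-rings. -/
abbrev CInfSpace : Type (u + 1) := CInfRingCat.{u}ᵒᵖ

/-- `Spec A` is the `C^∞`-ring `A` as an object of the opposite category. -/
abbrev spec (A : Type u) [CInfRing A] : CInfSpace.{u} := Opposite.op ⟨A⟩

/-- `C^∞(X)`. -/
abbrev functions (X : CInfSpace.{u}) : Type u := X.unop.carrier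

/-- `C^∞(X × X)`, the coproduct of two copies of `C^∞(X)`. -/
abbrev functionsSq (X : CInfSpace.{u}) : Type u := Coprod (functions X) (functions X)

/-- The ideal of the diagonal: the kernel of the codiagonal `C^∞(X × X) → C^∞(X)`. -/
noncomputable def diagonalIdeal (X : CInfSpace.{u}) : Ideal (functionsSq X) :=
  RingHom.ker (Coprod.desc (CInfHom.id (functions X)) (CInfHom.id (functions X))).toRingHom

/-- The closed subspaces `I ↦ Spec (A ⧸ I)`, a functor on the ideals ordered by reverse
inclusion. -/
noncomputable def specQuotient (A : Type u) [CInfRing A] : (Ideal A)ᵒᵈ ⥤ CInfSpace.{u} where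
  obj I := spec (A ⧸ OrderDual.ofDual I)
  map {I J} h :=
    Quiver.Hom.op (X := (⟨A ⧸ OrderDual.ofDual J⟩ : CInfRingCat.{u}))
      (Y := ⟨A ⧸ OrderDual.ofDual I⟩) (quotientFactor (OrderDual.ofDual_le_ofDual.2 (leOfHom h)))
  map_id I := by
    apply Quiver.Hom.unop_inj
    apply CInfHom.ext
    funext x
    obtain ⟨x, rfl⟩ := Ideal.Quotient.mk_surjective x
    rfl
  map_comp f g := by
    apply Quiver.Hom.unop_inj
    apply CInfHom.ext
    funext x
    obtain ⟨x, rfl⟩ := Ideal.Quotient.mk_surjective x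
    rfl

/-- The pre-sheaves represented by the closed subspaces `Spec (C^∞(X × X) ⧸ I)` of `X × X`. -/
noncomputable def closedSubspaces (X : CInfSpace.{u}) :
    (Ideal (functionsSq X))ᵒᵈ ⥤ (CInfSpace.{u}ᵒᵖ ⥤ Type u) :=
  specQuotient (functionsSq X) ⋙ yoneda

/-! The two neighbourhoods of the diagonal -/

/-- The ideals of `C^∞(X × X)` with the same nilradical as the ideal of the diagonal, ordered by
reverse inclusion. -/
abbrev NilIdeals (X : CInfSpace.{u}) : Type u :=
  {I : (Ideal (functionsSq X))ᵒᵈ // (OrderDual.ofDual I).radical = (diagonalIdeal X).radical}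

/-- The ideals of `C^∞(X × X)` with the same `∞`-radical as the ideal of the diagonal, ordered by
reverse inclusion. -/
abbrev InfIdeals (X : CInfSpace.{u}) : Type u :=
  {I : (Ideal (functionsSq X))ᵒᵈ // infRadical (OrderDual.ofDual I) = infRadical (diagonalIdeal X)}

/-- The diagram of all `Spec (C^∞(X × X) ⧸ I)` with `I` in `NilIdeals X`. -/
noncomputable def nilDiagram (X : CInfSpace.{u}) : NilIdeals X ⥤ (CInfSpace.{u}ᵒᵖ ⥤ Type u) :=
  (Subtype.mono_coe _).functor ⋙ closedSubspaces X

/-- The diagram of all `Spec (C^∞(X × X) ⧸ I)` with `I` in `InfIdeals X`. -/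
noncomputable def infDiagram (X : CInfSpace.{u}) : InfIdeals X ⥤ (CInfSpace.{u}ᵒᵖ ⥤ Type u) :=
  (Subtype.mono_coe _).functor ⋙ closedSubspaces X

/-- The formal neighbourhood of the diagonal, as a pre-sheaf. -/
noncomputable def nilNeighbourhood (X : CInfSpace.{u}) : CInfSpace.{u}ᵒᵖ ⥤ Type u :=
  colimit (nilDiagram X)

/-- The `∞`-neighbourhood of the diagonal, as a pre-sheaf. -/
noncomputable def infNeighbourhood (X : CInfSpace.{u}) : CInfSpace.{u}ᵒᵖ ⥤ Type u :=
  colimit (infDiagram X)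

/-! The two smaller diagrams -/

/-- The sequence `k ↦ Spec (C^∞(X × X) ⧸ I_Δ ^ k)`, `k ≥ 1`. -/
noncomputable def powerDiagram (X : CInfSpace.{u}) : ℕ+ ⥤ (CInfSpace.{u}ᵒᵖ ⥤ Type u) :=
  Monotone.functor (f := fun k : ℕ+ => OrderDual.toDual (diagonalIdeal X ^ (k : ℕ)))
    (fun _ _ h => OrderDual.toDual_le_toDual.2 (Ideal.pow_le_pow_right h)) ⋙ closedSubspaces X

/-- The power `I_Δ ^ k` as an element of `NilIdeals X`. -/
noncomputable def powerIdeal (X : CInfSpace.{u}) (k : ℕ+) : NilIdeals X :=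
  ⟨OrderDual.toDual (diagonalIdeal X ^ (k : ℕ)), Ideal.radical_pow _ k.ne_zero⟩

/-- The functions `f` on `X × X` such that `(f)` has the same `∞`-radical as the ideal of the
diagonal. -/
def CharFunctions (X : CInfSpace.{u}) : Type u :=
  {f : functionsSq X // infRadical (Ideal.span {f}) = infRadical (diagonalIdeal X)}

/-- The principal ideal `(f)` as an element of `InfIdeals X`. -/
noncomputable def principalIdeal (X : CInfSpace.{u}) (f : CharFunctions X) : InfIdeals X :=
  ⟨OrderDual.toDual (Ideal.span {f.1}), f.2⟩

/-- `f ≤ g` if and only if `(g) ⊆ (f)`. -/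
noncomputable instance (X : CInfSpace.{u}) : Preorder (CharFunctions X) := Preorder.lift (principalIdeal X)

/-- The diagram of all `Spec (C^∞(X × X) ⧸ (f))` with `f` in `CharFunctions X`. -/
noncomputable def principalDiagram (X : CInfSpace.{u}) : CharFunctions X ⥤ (CInfSpace.{u}ᵒᵖ ⥤ Type u) :=
  Monotone.functor
    (f := fun f : CharFunctions X => OrderDual.toDual (Ideal.span {f.1})) (fun _ _ h => h) ⋙
    closedSubspaces X

end CInf

/-! Both isomorphisms are cofinality statements: restricting a diagram along a final functor does
not change its colimit. A monotone map out of a directed preorder is final as soon as every index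
lies below a value of the map (`final_of_cofinal`). For reverse inclusion this asks that every ideal
with the nilradical of `I_Δ` contain a power of `I_Δ`, and that every ideal with the `∞`-radical of
`I_Δ` contain some `f` for which `(f)` still has that `∞`-radical.

Finite generation enters through a surjection from `C^∞(ℝⁿ)` onto `C^∞(X)`. It makes `C^∞(X × X)` a
quotient of `C^∞(ℝⁿ × ℝⁿ)`, and Hadamard's lemma, in the form `op_sub_mem`, shows that the classes
of the `n` functions `xᵢ - yᵢ` generate `I_Δ` (`ker_codiagonal_eq_span`). A finitely generated ideal
inside the radical of `I` has a power inside `I`; this settles the first half.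

For the second half, `mem_infRadical_iff` turns `∞`-radicals into zero sets. The class of `d = ∑ (xᵢ
- yᵢ)²` lies in `I_Δ`, hence in the `∞`-radical of `I`, so some `g` with class in `I` has all its
zeros on the diagonal. Each `xᵢ - yᵢ` then lies in the `∞`-radical of `(g)`. Thus `(g)` is contained
in `I` and has the `∞`-radical of `I_Δ`. Such principal ideals are directed because products of
their generators are again of this kind. -/

namespace CInf

open SmoothOps

/-! Morphisms out of `C^∞(ℝⁿ)` and out of its quotients -/

namespace Smooth

theorem op_proj_self {n : ℕ} (f : Smooth n) : op f (proj : Fin n → Smooth n) = f := rfl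

end Smooth

namespace CInfHom

theorem map_op_apply {A : Type u} {B : Type v} [CInfRing A] [CInfRing B] (φ : CInfHom A B) {n : ℕ}
    (f : Smooth n) (a : Fin n → A) : φ.toRingHom (op f a) = op f fun i => φ.toRingHom (a i) :=
  φ.map_op f a

/-- The morphism `C^∞(ℝⁿ) → A` that sends the coordinates to given elements. -/
def ofTuple {A : Type u} [CInfRing A] {n : ℕ} (a : Fin n → A) : CInfHom (Smooth n) A :=
  ⟨fun f => op f a, fun f g => op_comp f g a⟩

/-- A morphism factors through a surjective one with smaller kernel. -/
noncomputable def factor {A : Type u} {B : Type v} {C : Type w} [CInfRing A] [CInfRing B]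
    [CInfRing C] (φ : CInfHom A B) (hφ : Function.Surjective φ.toRingHom) (ψ : CInfHom A C)
    (h : RingHom.ker φ.toRingHom ≤ RingHom.ker ψ.toRingHom) : CInfHom B C where
  toFun := RingHom.liftOfSurjective φ.toRingHom hφ ⟨ψ.toRingHom, h⟩
  map_op f b := by
    obtain ⟨a, rfl⟩ : ∃ a : Fin _ → A, (fun i => φ.toRingHom (a i)) = b :=
      ⟨_, funext fun i => Function.surjInv_eq hφ (b i)⟩
    rw [← map_op_apply]
    simp only [RingHom.liftOfSurjective, RingHom.liftOfRightInverse_comp_apply]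
    exact ψ.map_op f _

theorem factor_apply {A : Type u} {B : Type v} {C : Type w} [CInfRing A] [CInfRing B]
    [CInfRing C] (φ : CInfHom A B) (hφ : Function.Surjective φ.toRingHom) (ψ : CInfHom A C)
    (h : RingHom.ker φ.toRingHom ≤ RingHom.ker ψ.toRingHom) (a : A) :
    (factor φ hφ ψ h).toRingHom (φ.toRingHom a) = ψ.toRingHom a :=
  RingHom.liftOfRightInverse_comp_apply _ _ (Function.rightInverse_surjInv hφ)
    ⟨ψ.toRingHom, h⟩ a

theorem apply_eq_op {A : Type u} [CInfRing A] {n : ℕ} (φ : CInfHom (Smooth n) A) (f : Smooth n) :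
    φ.toRingHom f = op f fun i => φ.toRingHom (Smooth.proj i) := by
  rw [← map_op_apply, Smooth.op_proj_self]

end CInfHom

/-! The `∞`-radical in terms of zero sets -/

theorem Smooth.isUnit_of_forall_ne_zero {n : ℕ} (f : Smooth n) (hf : ∀ x, f.1 x ≠ 0) :
    IsUnit f :=
  IsUnit.of_mul_eq_one ⟨fun x => (f.1 x)⁻¹, show ContDiff ℝ ∞ _ from f.contDiff.inv hf⟩
    (Subtype.ext (funext fun x => mul_inv_cancel₀ (hf x)))

/-- The pullback along the projection `ℝⁿ⁺¹ → ℝⁿ` that forgets the first coordinate. -/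
def Smooth.pullTail {n : ℕ} : CInfHom (Smooth n) (Smooth (n + 1)) :=
  CInfHom.ofTuple fun i => Smooth.proj i.succ

/-- The functions on `ℝⁿ⁺¹` that vanish on the part of the graph of `1 / f` over the zero set of
some element of `I`. -/
noncomputable def graphIdeal {n : ℕ} (I : Ideal (Smooth n)) (f : Smooth n) :
    Ideal (Smooth (n + 1)) where
  carrier := {h | ∃ g ∈ I, ∀ x, g.1 x = 0 → f.1 x ≠ 0 → h.1 (Fin.cons (f.1 x)⁻¹ x) = 0}
  zero_mem' := ⟨0, I.zero_mem, fun _ _ _ => rfl⟩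
  add_mem' := by
    rintro a b ⟨g, hg, ha⟩ ⟨k, hk, hb⟩
    -- Over the reals, a sum of two squares vanishes exactly at the common zeros.
    refine ⟨g * g + k * k, I.add_mem (I.mul_mem_left _ hg) (I.mul_mem_left _ hk),
      fun x hx hf => ?_⟩
    have hx' : g.1 x * g.1 x + k.1 x * k.1 x = 0 := hx
    obtain ⟨h1, h2⟩ := mul_self_add_mul_self_eq_zero.1 hx'
    change a.1 _ + b.1 _ = 0
    rw [ha x h1 hf, hb x h2 hf, add_zero]
  smul_mem' := by
    rintro c a ⟨g, hg, ha⟩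
    refine ⟨g, hg, fun x hx hf => ?_⟩
    change c.1 _ * a.1 _ = 0
    rw [ha x hx hf, mul_zero]

section Radical

variable {A : Type u} [CInfRing A] {n : ℕ} (φ : CInfHom (Smooth n) A)

/-- The canonical morphism from `A` to the localization of `A ⧸ I` at `a`. -/
noncomputable def toLocalization (I : Ideal A) (a : A) :
    CInfHom A (SmoothLocalization (A ⧸ I) (Ideal.Quotient.mk I a)) :=
  (quotientMk _).comp ((Coprod.inl _ _).comp (quotientMk I))

/-- With `y` the adjoined inverse, `g` and `f y - 1` both become zero in the localization. As
functions on `ℝⁿ⁺¹` they have no common zero, since `g = 0` forces `f = 0`. The sum of their squares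
is therefore a unit that maps to zero, so the localization is the zero ring. -/
theorem mem_infRadical_of_zeros {I : Ideal A} {f g : Smooth n} (hg : φ.toRingHom g ∈ I)
    (hfg : ∀ x, g.1 x = 0 → f.1 x = 0) : φ.toRingHom f ∈ infRadical I := by
  set L := SmoothLocalization (A ⧸ I) (Ideal.Quotient.mk I (φ.toRingHom f))
  let ψ : CInfHom A L := toLocalization I (φ.toRingHom f)
  let y : L := Ideal.Quotient.mk _ (Coprod.inr (A ⧸ I) (Smooth 1) (Smooth.proj 0))
  let χ : CInfHom (Smooth (n + 1)) L :=
    CInfHom.ofTuple (Fin.cons y fun i => ψ.toRingHom (φ.toRingHom (Smooth.proj i)))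
  have hχ : ∀ k : Smooth n, χ.toRingHom (Smooth.pullTail.toRingHom k) =
      ψ.toRingHom (φ.toRingHom k) := fun k => by
    rw [φ.apply_eq_op k, ψ.map_op_apply]
    change op (Smooth.comp k _) _ = _
    rw [SmoothOps.op_comp]
    congr 1
    funext i
    rw [op_proj]
    rfl
  have hy : χ.toRingHom (Smooth.proj 0) = y := op_proj _ _
  have hg0 : ψ.toRingHom (φ.toRingHom g) = 0 := by
    have h0 : (quotientMk I).toRingHom (φ.toRingHom g) = 0 := Ideal.Quotient.eq_zero_iff_mem.2 hg
    change (quotientMk _).toRingHom ((Coprod.inl _ _).toRingHom ((quotientMk I).toRingHom _)) = 0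
    rw [h0, map_zero, map_zero]
  have hf1 : ψ.toRingHom (φ.toRingHom f) * y - 1 = 0 := by
    have := Ideal.Quotient.eq_zero_iff_mem.2 (Ideal.mem_span_singleton_self
      (Coprod.inl (A ⧸ I) (Smooth 1) (Ideal.Quotient.mk I (φ.toRingHom f)) *
        Coprod.inr (A ⧸ I) (Smooth 1) (Smooth.proj 0) - 1))
    rw [map_sub, map_mul, map_one] at this
    exact this
  let k : Smooth (n + 1) := Smooth.pullTail.toRingHom f * Smooth.proj 0 - 1
  let l : Smooth (n + 1) := Smooth.pullTail.toRingHom g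
  have hu : IsUnit (l * l + k * k) := by
    refine Smooth.isUnit_of_forall_ne_zero _ fun z hz => ?_
    obtain ⟨h1, h2⟩ := mul_self_add_mul_self_eq_zero.1
      (show l.1 z * l.1 z + k.1 z * k.1 z = 0 from hz)
    have h3 : f.1 (fun i => z i.succ) * z 0 - 1 = 0 := h2
    rw [hfg (fun i => z i.succ) h1] at h3
    norm_num at h3
  have h0 : χ.toRingHom (l * l + k * k) = 0 := by
    simp only [l, k, map_add, map_mul, map_sub, map_one, hχ, hg0, hy, hf1, mul_zero, add_zero]
  exact isUnit_zero_iff.1 (h0 ▸ hu.map χ.toRingHom) |> subsingleton_of_zero_eq_one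

/-- The localization is tested against the functions on the graph of `1 / f` over the zero sets of
elements of `I`, that is, the quotient by `graphIdeal`. It maps there by sending the adjoined
inverse to the first coordinate. If it is zero, so is the target, and the germ-like definition of
`graphIdeal` produces `g`. -/
theorem exists_zeros_of_mem_infRadical (hφ : Function.Surjective φ.toRingHom) {I : Ideal A}
    {f : Smooth n} (hf : φ.toRingHom f ∈ infRadical I) :
    ∃ g, φ.toRingHom g ∈ I ∧ ∀ x, g.1 x = 0 → f.1 x = 0 := by
  let K := graphIdeal (I.comap φ.toRingHom) f
  let φ' : CInfHom (Smooth n) (A ⧸ I) := (quotientMk I).comp φ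
  have hφ' : Function.Surjective φ'.toRingHom := Ideal.Quotient.mk_surjective.comp hφ
  let ψ' : CInfHom (Smooth n) (Smooth (n + 1) ⧸ K) := (quotientMk K).comp Smooth.pullTail
  have hker : RingHom.ker φ'.toRingHom ≤ RingHom.ker ψ'.toRingHom := fun g hg =>
    Ideal.Quotient.eq_zero_iff_mem.2
      -- The pullback of `g` ignores the first coordinate, so `g` is its own witness.
      ⟨g, (Ideal.Quotient.eq_zero_iff_mem (I := I)).1 hg, fun x hx _ => hx⟩
  let ψ := CInfHom.factor φ' hφ' ψ' hker
  let y : Smooth (n + 1) ⧸ K := Ideal.Quotient.mk K (Smooth.proj 0)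
  let δ := Coprod.desc ψ (CInfHom.ofTuple fun _ : Fin 1 => y)
  have hδ : δ.toRingHom (Coprod.inl (A ⧸ I) (Smooth 1) (Ideal.Quotient.mk I (φ.toRingHom f)) *
      Coprod.inr (A ⧸ I) (Smooth 1) (Smooth.proj 0) - 1) = 0 := by
    have h1 : δ.toRingHom (Coprod.inl (A ⧸ I) (Smooth 1) (Ideal.Quotient.mk I (φ.toRingHom f))) =
        Ideal.Quotient.mk K (Smooth.pullTail.toRingHom f) :=
      CInfHom.factor_apply φ' hφ' ψ' hker f
    have h2 : δ.toRingHom (Coprod.inr (A ⧸ I) (Smooth 1) (Smooth.proj 0)) =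
        Ideal.Quotient.mk K (Smooth.proj 0) := op_proj (0 : Fin 1) _
    rw [map_sub, map_mul, map_one, h1, h2, ← map_mul, ← map_one (Ideal.Quotient.mk K), ← map_sub,
      Ideal.Quotient.eq_zero_iff_mem]
    -- The relation holds on the whole graph of `1 / f`, so no restriction to a smaller zero set is
    -- needed and `0` is a witness.
    refine ⟨0, Ideal.zero_mem _, fun x _ hx => ?_⟩
    change f.1 x * (f.1 x)⁻¹ - 1 = 0
    rw [mul_inv_cancel₀ hx, sub_self]
  -- A zero localization means that the relation generates the unit ideal. As `δ` kills the
  -- relation, it kills `1`.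
  have hone := Ideal.Quotient.subsingleton_iff.1 hf
  have h1 : (1 : Coprod (A ⧸ I) (Smooth 1)) ∈ RingHom.ker δ.toRingHom :=
    (Ideal.span_singleton_le_iff_mem _).2 hδ (hone ▸ Submodule.mem_top)
  have h2 : (1 : Smooth (n + 1)) ∈ K := by
    rw [← Ideal.Quotient.eq_zero_iff_mem, map_one, ← map_one δ.toRingHom]
    exact h1
  obtain ⟨g, hg, h⟩ := h2
  -- The constant `1` vanishes nowhere, so the part of the graph over the zeros of `g` is empty.
  exact ⟨g, hg, fun x hx => by_contra fun hfx => one_ne_zero (h x hx hfx : (1 : ℝ) = 0)⟩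

/-- If `φ : C^∞(ℝⁿ) → A` is surjective, then `φ f` is in the `∞`-radical of `I` if and only if `f`
vanishes on the zero set of some `g` with `φ g ∈ I`. -/
theorem mem_infRadical_iff (hφ : Function.Surjective φ.toRingHom) {I : Ideal A} {f : Smooth n} :
    φ.toRingHom f ∈ infRadical I ↔ ∃ g, φ.toRingHom g ∈ I ∧ ∀ x, g.1 x = 0 → f.1 x = 0 :=
  ⟨exists_zeros_of_mem_infRadical φ hφ, fun ⟨_, hg, h⟩ => mem_infRadical_of_zeros φ hg h⟩

end Radical

/-! ### Calculus of `∞`-radicals in finitely generated rings -/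

section FinitelyGenerated

variable {A : Type u} [CInfRing A]

theorem IsFinitelyGenerated.subset_infRadical (hA : IsFinitelyGenerated A) (I : Ideal A) :
    (I : Set A) ⊆ infRadical I := by
  obtain ⟨n, φ, hφ⟩ := hA
  intro a ha
  obtain ⟨f, rfl⟩ := hφ a
  exact (mem_infRadical_iff φ hφ).2 ⟨f, ha, fun _ h => h⟩

theorem IsFinitelyGenerated.infRadical_mono (hA : IsFinitelyGenerated A) {I J : Ideal A}
    (h : I ≤ J) : infRadical I ⊆ infRadical J := by
  obtain ⟨n, φ, hφ⟩ := hA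
  intro a ha
  obtain ⟨f, rfl⟩ := hφ a
  obtain ⟨g, hg, hgf⟩ := (mem_infRadical_iff φ hφ).1 ha
  exact (mem_infRadical_iff φ hφ).2 ⟨g, h hg, hgf⟩

/-- Closure under sums comes from `g² + g'²`, which cuts out the common zeros. The ideal structure
allows an inclusion into an `∞`-radical to be checked on generators. -/
theorem IsFinitelyGenerated.exists_ideal_eq_infRadical (hA : IsFinitelyGenerated A)
    (I : Ideal A) : ∃ J : Ideal A, (J : Set A) = infRadical I := by
  obtain ⟨n, φ, hφ⟩ := hA
  refine ⟨{ carrier := infRadical I, zero_mem' := ?_, add_mem' := ?_, smul_mem' := ?_ }, rfl⟩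
  · intro a b ha hb
    obtain ⟨f, rfl⟩ := hφ a
    obtain ⟨f', rfl⟩ := hφ b
    obtain ⟨g, hg, h⟩ := (mem_infRadical_iff φ hφ).1 ha
    obtain ⟨g', hg', h'⟩ := (mem_infRadical_iff φ hφ).1 hb
    have : φ.toRingHom (f + f') ∈ infRadical I := by
      refine (mem_infRadical_iff φ hφ).2 ⟨g * g + g' * g', ?_, fun x hx => ?_⟩
      · rw [map_add, map_mul, map_mul]
        exact I.add_mem (I.mul_mem_left _ hg) (I.mul_mem_left _ hg')
      · obtain ⟨h1, h2⟩ := mul_self_add_mul_self_eq_zero.1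
          (show g.1 x * g.1 x + g'.1 x * g'.1 x = 0 from hx)
        change f.1 x + f'.1 x = 0
        rw [h x h1, h' x h2, add_zero]
    rwa [map_add] at this
  · have : φ.toRingHom 0 ∈ infRadical I :=
      (mem_infRadical_iff φ hφ).2 ⟨0, by rw [map_zero]; exact I.zero_mem, fun _ h => h⟩
    rwa [map_zero] at this
  · intro c a ha
    obtain ⟨f, rfl⟩ := hφ a
    obtain ⟨k, rfl⟩ := hφ c
    obtain ⟨g, hg, h⟩ := (mem_infRadical_iff φ hφ).1 ha
    have : φ.toRingHom (k * f) ∈ infRadical I := by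
      refine (mem_infRadical_iff φ hφ).2 ⟨g, hg, fun x hx => ?_⟩
      change k.1 x * f.1 x = 0
      rw [h x hx, mul_zero]
    rwa [map_mul] at this

/-- Inclusions of zero sets compose. -/
theorem IsFinitelyGenerated.infRadical_subset (hA : IsFinitelyGenerated A) {I J : Ideal A}
    (h : (I : Set A) ⊆ infRadical J) : infRadical I ⊆ infRadical J := by
  obtain ⟨n, φ, hφ⟩ := hA
  intro a ha
  obtain ⟨f, rfl⟩ := hφ a
  obtain ⟨g, hg, hgf⟩ := (mem_infRadical_iff φ hφ).1 ha
  obtain ⟨k, hk, hkg⟩ := (mem_infRadical_iff φ hφ).1 (h hg)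
  exact (mem_infRadical_iff φ hφ).2 ⟨k, hk, fun x hx => hgf x (hkg x hx)⟩

/-- The zero set of a product is the union of the zero sets. -/
theorem IsFinitelyGenerated.infRadical_mul (hA : IsFinitelyGenerated A) (I J : Ideal A) :
    infRadical (I * J) = infRadical I ∩ infRadical J := by
  refine Set.Subset.antisymm (Set.subset_inter (hA.infRadical_mono Ideal.mul_le_left)
    (hA.infRadical_mono Ideal.mul_le_right)) ?_
  obtain ⟨n, φ, hφ⟩ := hA
  rintro a ⟨ha, hb⟩
  obtain ⟨f, rfl⟩ := hφ a
  obtain ⟨g, hg, hgf⟩ := (mem_infRadical_iff φ hφ).1 ha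
  obtain ⟨k, hk, hkf⟩ := (mem_infRadical_iff φ hφ).1 hb
  refine (mem_infRadical_iff φ hφ).2
    ⟨g * k, by rw [map_mul]; exact Ideal.mul_mem_mul hg hk, fun x hx => ?_⟩
  exact (mul_eq_zero.1 (show g.1 x * k.1 x = 0 from hx)).elim (hgf x) (hkf x)

/-! The square of a finitely generated `C^∞`-ring and its diagonal ideal -/

variable {n : ℕ} (φ : CInfHom (Smooth n) A)

/-- The morphism `C^∞(ℝⁿ × ℝⁿ) → A ⊗ A` induced by `φ : C^∞(ℝⁿ) → A`. -/
noncomputable def squareMap : CInfHom (Smooth (n + n)) (Coprod A A) :=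
  CInfHom.ofTuple (Fin.append (fun i => (Coprod.inl A A).toRingHom (φ.toRingHom (Smooth.proj i)))
    fun i => (Coprod.inr A A).toRingHom (φ.toRingHom (Smooth.proj i)))

theorem squareMap_surjective (hφ : Function.Surjective φ.toRingHom) :
    Function.Surjective (squareMap φ).toRingHom := by
  intro x
  induction x using Quotient.inductionOn with
  | h t =>
    induction t with
    | inl a =>
      obtain ⟨f, rfl⟩ := hφ a
      refine ⟨Smooth.comp f fun i => Smooth.proj (Fin.castAdd n i), ?_⟩
      refine Eq.trans ?_ ((congrArg _ (φ.apply_eq_op f)).trans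
        ((Coprod.inl A A).map_op_apply f _)).symm
      refine (SmoothOps.op_comp _ _ _).trans (congrArg (op f) (funext fun i => ?_))
      rw [op_proj, Fin.append_left]
    | inr a =>
      obtain ⟨f, rfl⟩ := hφ a
      refine ⟨Smooth.comp f fun i => Smooth.proj (Fin.natAdd n i), ?_⟩
      refine Eq.trans ?_ ((congrArg _ (φ.apply_eq_op f)).trans
        ((Coprod.inr A A).map_op_apply f _)).symm
      refine (SmoothOps.op_comp _ _ _).trans (congrArg (op f) (funext fun i => ?_))
      rw [op_proj, Fin.append_right]
    | op f t ih =>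
      choose g hg using ih
      refine ⟨op f g, ?_⟩
      rw [CInfHom.map_op_apply, ← Coprod.op_mk]
      exact congrArg (op f) (funext hg)

/-- The function `xᵢ - yᵢ` on `ℝⁿ × ℝⁿ`. -/
def Smooth.diff (i : Fin n) : Smooth (n + n) :=
  Smooth.proj (Fin.castAdd n i) - Smooth.proj (Fin.natAdd n i)

theorem squareMap_diff (i : Fin n) : (squareMap φ).toRingHom (Smooth.diff i) =
    (Coprod.inl A A).toRingHom (φ.toRingHom (Smooth.proj i)) -
      (Coprod.inr A A).toRingHom (φ.toRingHom (Smooth.proj i)) := by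
  rw [Smooth.diff, map_sub]
  exact congrArg₂ (· - ·) ((op_proj _ _).trans (Fin.append_left _ _ i))
    ((op_proj _ _).trans (Fin.append_right _ _ i))

/-- Modulo the differences, every coordinate of the square agrees with its image under the
codiagonal followed by the first inclusion. By Hadamard's lemma the same congruence holds for every
smooth function of the coordinates, and an element of the kernel is thus congruent to zero. -/
theorem ker_codiagonal_eq_span (hφ : Function.Surjective φ.toRingHom) :
    RingHom.ker (Coprod.desc (CInfHom.id A) (CInfHom.id A)).toRingHom =
      Ideal.span (Set.range fun i => (squareMap φ).toRingHom (Smooth.diff i)) := by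
  set δ := Coprod.desc (CInfHom.id A) (CInfHom.id A)
  have hl : ∀ a, δ.toRingHom ((Coprod.inl A A).toRingHom a) = a := fun _ => rfl
  have hr : ∀ a, δ.toRingHom ((Coprod.inr A A).toRingHom a) = a := fun _ => rfl
  apply le_antisymm
  · intro c hc
    obtain ⟨F, rfl⟩ := squareMap_surjective φ hφ c
    let a : Fin n → A := fun i => φ.toRingHom (Smooth.proj i)
    let v : Fin (n + n) → Coprod A A := Fin.append
      (fun i => (Coprod.inl A A).toRingHom (a i)) fun i => (Coprod.inr A A).toRingHom (a i)
    -- Morphisms commute with `F`, so the left side is the first inclusion applied to the codiagonal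
    -- of an element of the kernel.
    have hv : op F (fun j => (Coprod.inl A A).toRingHom (δ.toRingHom (v j))) = 0 := by
      rw [← CInfHom.map_op_apply, ← CInfHom.map_op_apply]
      exact (congrArg _ hc).trans (map_zero _)
    have := op_sub_mem (Ideal.span (Set.range fun i => (squareMap φ).toRingHom (Smooth.diff i))) F
      (fun j => (Coprod.inl A A).toRingHom (δ.toRingHom (v j))) v fun j => by
        refine Fin.addCases (fun i => ?_) (fun i => ?_) j
        · simp only [v, Fin.append_left, hl, sub_self]
          exact Ideal.zero_mem _
        · simp only [v, Fin.append_right, hr]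
          rw [← squareMap_diff]
          exact Ideal.subset_span ⟨i, rfl⟩
    rw [hv, zero_sub] at this
    exact (Ideal.neg_mem_iff _).1 this
  · rw [Ideal.span_le]
    rintro _ ⟨i, rfl⟩
    change δ.toRingHom _ = 0
    beta_reduce
    rw [squareMap_diff, map_sub, hl, hr, sub_self]

end FinitelyGenerated

/-! ### Cofinality of the powers of `I_Δ` and of the principal ideals -/

section Neighbourhoods

variable (X : CInfSpace.{u})

theorem isFinitelyGenerated_functionsSq (hX : IsFinitelyGenerated (functions X)) :
    IsFinitelyGenerated (functionsSq X) := by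
  obtain ⟨n, φ, hφ⟩ := hX
  exact ⟨n + n, squareMap φ, squareMap_surjective φ hφ⟩

theorem diagonalIdeal_fg (hX : IsFinitelyGenerated (functions X)) : (diagonalIdeal X).FG := by
  obtain ⟨n, φ, hφ⟩ := hX
  rw [diagonalIdeal, ker_codiagonal_eq_span φ hφ]
  exact Submodule.fg_span (Set.finite_range _)

theorem exists_pow_diagonalIdeal_le (hX : IsFinitelyGenerated (functions X)) (I : NilIdeals X) :
    ∃ k : ℕ+, I ≤ powerIdeal X k := by
  obtain ⟨k, hk⟩ := Ideal.exists_pow_le_of_le_radical_of_fg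
    (Ideal.le_radical.trans I.2.ge) (diagonalIdeal_fg X hX)
  -- The exponent obtained may be `0`; passing to `k + 1` makes it positive and only shrinks the
  -- power.
  exact ⟨k.succPNat, show diagonalIdeal X ^ (k + 1) ≤ OrderDual.ofDual I.1 from
    (Ideal.pow_le_pow_right k.le_succ).trans hk⟩

theorem exists_charFunction_mem (hX : IsFinitelyGenerated (functions X)) (I : InfIdeals X) :
    ∃ f : CharFunctions X, I ≤ principalIdeal X f := by
  have hA := isFinitelyGenerated_functionsSq X hX
  obtain ⟨n, φ, hφ⟩ := hX
  have hΦ := squareMap_surjective φ hφ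
  have hΔ : diagonalIdeal X = _ := ker_codiagonal_eq_span φ hφ
  -- The zero set of `d` is exactly the diagonal of `ℝⁿ × ℝⁿ`, so a single function replaces the `n`
  -- generators.
  let d : Smooth (n + n) := ∑ i, Smooth.diff i * Smooth.diff i
  have hd : (squareMap φ).toRingHom d ∈ diagonalIdeal X := by
    rw [map_sum, hΔ]
    refine Ideal.sum_mem _ fun i _ => ?_
    rw [map_mul]
    exact Ideal.mul_mem_left _ _ (Ideal.subset_span ⟨i, rfl⟩)
  obtain ⟨g, hg, hgd⟩ := (mem_infRadical_iff _ hΦ).1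
    (I.2.ge (hA.subset_infRadical _ hd))
  have hle : Ideal.span {(squareMap φ).toRingHom g} ≤ OrderDual.ofDual I.1 :=
    (Ideal.span_singleton_le_iff_mem _).2 hg
  -- One inclusion of radicals follows from `(g) ≤ I`; the other reduces to `I_Δ` lying in the
  -- `∞`-radical of `(g)`.
  refine ⟨⟨(squareMap φ).toRingHom g, Set.Subset.antisymm
    ((hA.infRadical_mono hle).trans I.2.le) (hA.infRadical_subset ?_)⟩, hle⟩
  obtain ⟨J, hJ⟩ := hA.exists_ideal_eq_infRadical (Ideal.span {(squareMap φ).toRingHom g})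
  rw [← hJ, hΔ, SetLike.coe_subset_coe, Ideal.span_le, hJ]
  rintro _ ⟨i, rfl⟩
  refine (mem_infRadical_iff _ hΦ).2 ⟨g, Ideal.mem_span_singleton_self _, fun x hx => ?_⟩
  have h0 : ∑ i, (Smooth.diff i).1 x * (Smooth.diff i).1 x = 0 := by
    have := hgd x hx
    simpa [d, Finset.sum_apply] using this
  exact mul_self_eq_zero.1
    ((Finset.sum_eq_zero_iff_of_nonneg fun j _ => mul_self_nonneg _).1 h0 i (Finset.mem_univ i))

theorem isDirectedOrder_charFunctions (hX : IsFinitelyGenerated (functions X)) :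
    IsDirectedOrder (CharFunctions X) where
  directed f g := by
    have hA := isFinitelyGenerated_functionsSq X hX
    have hfg : Ideal.span {f.1 * g.1} = Ideal.span {f.1} * Ideal.span {g.1} :=
      (Ideal.span_singleton_mul_span_singleton _ _).symm
    refine ⟨⟨f.1 * g.1, ?_⟩, ?_, ?_⟩
    · rw [hfg, hA.infRadical_mul, f.2, g.2, Set.inter_self]
    · exact (hfg.le.trans Ideal.mul_le_left : Ideal.span {f.1 * g.1} ≤ Ideal.span {f.1})
    · exact (hfg.le.trans Ideal.mul_le_right : Ideal.span {f.1 * g.1} ≤ Ideal.span {g.1})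

theorem powerIdeal_monotone : Monotone (powerIdeal X) := fun _ _ h =>
  OrderDual.toDual_le_toDual.2 (Ideal.pow_le_pow_right h)

theorem principalIdeal_monotone : Monotone (principalIdeal X) := fun _ _ h => h

end Neighbourhoods

/-- A cofinal monotone map out of a directed preorder is a final functor. -/
theorem final_of_cofinal {P : Type v} {Q : Type w} [Preorder P] [Preorder Q] [IsDirectedOrder P]
    {f : P → Q} (hf : Monotone f) (h : ∀ q, ∃ p, q ≤ f p) : hf.functor.Final :=
  Functor.final_of_exists_of_isFiltered hf.functor
    (fun q => (h q).imp fun _ hp => ⟨homOfLE hp⟩)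
    -- Parallel arrows in a preorder are equal, so nothing has to be coequalized.
    (fun {_ c} _ _ => ⟨c, 𝟙 c, Subsingleton.elim _ _⟩)

end CInf

theorem mainTheorem7 (X : CInf.CInfSpace.{u})
    (hX : CInf.IsFinitelyGenerated (CInf.functions X)) :
    (∃ e : colimit (CInf.powerDiagram X) ≅ CInf.nilNeighbourhood X,
      ∀ k : ℕ+, colimit.ι (CInf.powerDiagram X) k ≫ e.hom =
        colimit.ι (CInf.nilDiagram X) (CInf.powerIdeal X k)) ∧
    (∃ e : colimit (CInf.principalDiagram X) ≅ CInf.infNeighbourhood X,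
      ∀ f : CInf.CharFunctions X, colimit.ι (CInf.principalDiagram X) f ≫ e.hom =
        colimit.ι (CInf.infDiagram X) (CInf.principalIdeal X f)) := by
  have := CInf.isDirectedOrder_charFunctions X hX
  have h₁ := CInf.final_of_cofinal (CInf.powerIdeal_monotone X)
    (CInf.exists_pow_diagonalIdeal_le X hX)
  have h₂ := CInf.final_of_cofinal (CInf.principalIdeal_monotone X)
    (CInf.exists_charFunction_mem X hX)
  -- The two smaller diagrams are, by definition, the restrictions of the large ones along
  -- `powerIdeal` and `principalIdeal`.
  exact ⟨⟨Functor.Final.colimitIso (CInf.powerIdeal_monotone X).functor (CInf.nilDiagram X),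
      fun k => Functor.Final.ι_colimitIso_hom (CInf.powerIdeal_monotone X).functor
        (CInf.nilDiagram X) k⟩,
    ⟨Functor.Final.colimitIso (CInf.principalIdeal_monotone X).functor (CInf.infDiagram X),
      fun f => Functor.Final.ι_colimitIso_hom (CInf.principalIdeal_monotone X).functor
        (CInf.infDiagram X) f⟩⟩
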